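/- Let $\mathbb K\in\{\mathbb R,\mathbb C\}$ and let $\mathbb K^{m\times n}$ carry the Frobenius inner product $\langle\cdot,\cdot\rangle$ and norm $\|\cdot\|$. Let $F\in\mathbb K^{m\times n}$, $\sigma_0\ge 0$, let $\mathcal M\subset\mathbb K^{m\times n}$ be a linear subspace, and let $\mathcal P_{\mathcal M^\perp}$ be the orthogonal projection onto $\mathcal M^\perp$. Put $$\mathscr N_F(X)=\sigma_0^2\,\mathrm{rank}(X)+\|X-F\|^2,$$ and denote by $\mathscr N_F^*(Y)=\sup_X\big(\mathrm{Re}\langle X,Y\rangle-\mathscr N_F(X)\big)$ its Fenchel conjugate and by $\mathscr N_F^{**}=(\mathscr N_F^*)^*$ its double conjugate. Let $f_0(x)=0$ for $x<\sigma_0$ and $f_0(x)=x$ for $x\ge\sigma_0$, and for a matrix with singular value decomposition $A=U\Sigma_\phi V^*$ put $\mathfrak S_{f_0}(A)=U\Sigma_{f_0(\phi)}V^*$. Let $(\alpha_i)_{i\ge0}$ satisfy $0<\alpha_i\le1$ for all $i$ and $$\lim_{N\to\infty}\Big(\sum_{i=1}^N\alpha_i^2\Big)\Big/\Big(\sum_{i=1}^N\alpha_i\Big)=0.$$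 Define $\Lambda^0=0$ and, for $i\ge0$, $$X^{i+1}=\mathfrak S_{f_0}\big(F-\tfrac12\Lambda^i\big),\qquad \Lambda^{i+1}=\Lambda^i+\alpha_i\,\mathcal P_{\mathcal M^\perp}(X^{i+1}).$$ For each $k\ge0$ let $n_k\in\{0,\dots,k\}$ be any index that maximizes $-\mathscr N_F^*(-\Lambda^i)$ over $0\le i\le k$. Then there is a strictly increasing sequence $(k_j)$ along which both $(X^{n_{k_j}+1})_j$ and $(\Lambda^{n_{k_j}})_j$ converge. Moreover, whenever $(k_j)$ is strictly increasing and $X^{n_{k_j}+1}\to X^\star$, $\Lambda^{n_{k_j}}\to\Lambda^\star$, and none of the $\min(m,n)$ singular values of $F-\tfrac12\Lambda^\star$ equals $\sigma_0$, one has $X^\star\in\mathcal M$ and $$\mathscr N_F^{**}(X^\star)=\min_{X\in\mathcal M}\mathscr N_F^{**}(X).$$ -/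

import Mathlib

open Filter Topology

/-! ### Fenchel conjugation -/

section Fenchel

variable (𝕜 : Type*) [RCLike 𝕜] {E : Type*} [NormedAddCommGroup E] [InnerProductSpace 𝕜 E]

/-- The Fenchel conjugate `f* (y) = sup_x (⟨x, y⟩ - f x)` of an extended-real-valued functional on a
real or complex inner product space. Over `ℂ` the pairing is the real part of the inner product. -/
noncomputable def fenchelConjugate (f : E → EReal) (y : E) : EReal :=
  ⨆ x : E, ((RCLike.re (inner 𝕜 x y) : ℝ) : EReal) - f x

/-- The double Fenchel conjugate `f** = (f*)*`, that is, the lower semicontinuous convex envelope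
of a functional which has a continuous affine minorant. -/
noncomputable def fenchelBiconjugate (f : E → EReal) : E → EReal :=
  fenchelConjugate 𝕜 (fenchelConjugate 𝕜 f)

end Fenchel

/-! ### The Hilbert space of `m × n` matrices with the Frobenius norm -/

attribute [local instance] Matrix.frobeniusNormedAddCommGroup

section Frobenius

variable {𝕜 : Type*} [RCLike 𝕜] {m n : ℕ}

/-- The Frobenius (Hilbert-Schmidt) inner product `⟨A, B⟩ = ∑ i j, conj (A i j) * B i j` on
`m × n` matrices. Its norm is Mathlib's Frobenius norm. -/
@[reducible]
noncomputable def frobeniusInnerProductSpace : InnerProductSpace 𝕜 (Matrix (Fin m) (Fin n) 𝕜) where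
  __ := Matrix.frobeniusNormedSpace
  inner A B := ∑ i, ∑ j, inner 𝕜 (A i j) (B i j)
  norm_sq_eq_re_inner A := by
    rw [Matrix.frobenius_norm_def, ← Real.sqrt_eq_rpow, Real.sq_sqrt (by positivity)]
    simp
  conj_inner_symm A B := by simp [map_sum, mul_comm]
  add_left A B C := by simp [mul_add, Finset.sum_add_distrib]
  smul_left A B r := by
    simp only [Matrix.smul_apply, inner_smul_left, Finset.mul_sum]

end Frobenius

attribute [local instance] frobeniusInnerProductSpace

/-! ### Singular values and the singular value functional calculus -/

section SingularValues

variable {𝕜 : Type*} [RCLike 𝕜] {m n : ℕ}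

/-- The singular values of an `m × n` matrix in decreasing order, indexed from `0`. The entries
with index `< min m n` are the singular values proper; the remaining ones are `0`. -/
noncomputable def singularValue (A : Matrix (Fin m) (Fin n) 𝕜) (j : ℕ) : ℝ :=
  (Matrix.toEuclideanLin A).singularValues j

theorem singularValue_eq_zero (A : Matrix (Fin m) (Fin n) 𝕜) {j : ℕ} (hj : min m n ≤ j) :
    singularValue A j = 0 := by
  refine (Matrix.toEuclideanLin A).singularValues_eq_zero_iff_le_finrank_range.mpr
    (le_trans (le_min ?_ ?_) hj)
  · exact (Submodule.finrank_le _).trans (by simp)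
  · exact (LinearMap.finrank_range_le _).trans (by simp)

/-- The rectangular `m × n` diagonal matrix with diagonal entries `φ 0, φ 1, …`. -/
def rectDiagonal (𝕜 : Type*) [RCLike 𝕜] (m n : ℕ) (φ : ℕ → ℝ) : Matrix (Fin m) (Fin n) 𝕜 :=
  Matrix.of fun i j => if (i : ℕ) = (j : ℕ) then ((φ j : ℝ) : 𝕜) else 0

/-- `A = U Σ V*` with `U`, `V` unitary and `Σ` the diagonal matrix of singular values of `A`. -/
def IsSVD (A : Matrix (Fin m) (Fin n) 𝕜) (U : Matrix (Fin m) (Fin m) 𝕜)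
    (V : Matrix (Fin n) (Fin n) 𝕜) : Prop :=
  U ∈ Matrix.unitaryGroup (Fin m) 𝕜 ∧ V ∈ Matrix.unitaryGroup (Fin n) 𝕜 ∧
    A = U * rectDiagonal 𝕜 m n (singularValue A) * V.conjTranspose

theorem exists_isSVD (A : Matrix (Fin m) (Fin n) 𝕜) : ∃ U V, IsSVD A U V := by
  classical
  set T := Matrix.toEuclideanLin A with hT
  have hn : Module.finrank 𝕜 (EuclideanSpace 𝕜 (Fin n)) = n := by simp
  set v := T.isSymmetric_adjoint_comp_self.eigenvectorBasis hn with hv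
  set σ := T.singularValues with hσ
  have hσv : ∀ j : Fin n, (LinearMap.adjoint T ∘ₗ T) (v j) = (((σ j) ^ 2 : ℝ) : 𝕜) • v j := by
    intro j
    rw [hσ, T.sq_singularValues_fin hn j]
    exact T.isSymmetric_adjoint_comp_self.apply_eigenvectorBasis hn j
  have hin : ∀ i j : Fin n, inner 𝕜 (T (v i)) (T (v j)) =
      if i = j then (((σ j) ^ 2 : ℝ) : 𝕜) else 0 := by
    intro i j
    rw [← LinearMap.adjoint_inner_right, ← LinearMap.comp_apply, hσv j, inner_smul_right,
      orthonormal_iff_ite.mp v.orthonormal i j]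
    simp
  have hzero : ∀ j : Fin n, σ j = 0 → T (v j) = 0 := by
    intro j hj
    have := hin j j
    rw [if_pos rfl, hj] at this
    simpa using this
  have hrange : ∀ i : ℕ, σ i ≠ 0 → i < m ∧ i < n := fun i hi =>
    lt_min_iff.mp (not_le.mp fun h => hi (singularValue_eq_zero A h))
  let w : Fin m → EuclideanSpace 𝕜 (Fin m) := fun i =>
    if h : (i : ℕ) < n then (((σ i)⁻¹ : ℝ) : 𝕜) • T (v ⟨i, h⟩) else 0
  let s : Set (Fin m) := {i | σ i ≠ 0}
  have hw : Orthonormal 𝕜 (s.domRestrict w) := by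
    rw [orthonormal_iff_ite]
    rintro ⟨i, hi⟩ ⟨j, hj⟩
    have hi' := (hrange i hi).2
    have hj' := (hrange j hj).2
    have hj0 : σ j ≠ 0 := hj
    simp only [Set.domRestrict_apply, w, dif_pos hi', dif_pos hj', inner_smul_left,
      inner_smul_right, hin, Subtype.mk.injEq, Fin.ext_iff]
    split_ifs with hij
    · rw [hij]
      have h2 : ((σ j : ℝ) : 𝕜) ≠ 0 := by exact_mod_cast hj0
      simp only [RCLike.conj_ofReal]
      push_cast
      field_simp
    · simp
  obtain ⟨u, hu⟩ := hw.exists_orthonormalBasis_extension_of_card_eq (by simp)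
  have hTv : ∀ j : Fin n, ∀ i : Fin m, (T (v j)).ofLp i =
      ∑ k : Fin m, (u k).ofLp i * rectDiagonal 𝕜 m n (singularValue A) k j := by
    intro j i
    by_cases hj : σ j = 0
    · rw [hzero j hj]
      symm
      simp only [PiLp.zero_apply]
      apply Finset.sum_eq_zero
      intro k _
      simp only [rectDiagonal, Matrix.of_apply]
      have : singularValue A j = 0 := hj
      split_ifs <;> simp [this]
    · have hjm := (hrange j hj).1
      rw [Finset.sum_eq_single (⟨j, hjm⟩ : Fin m)]
      · have h1 := hu ⟨j, hjm⟩ hj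
        have h2 : ((σ j : ℝ) : 𝕜) ≠ 0 := by exact_mod_cast hj
        have h3 : singularValue A j = σ j := rfl
        rw [h1]
        simp only [w, rectDiagonal, Matrix.of_apply, Fin.is_lt, dif_pos, Fin.eta, if_true, h3,
          PiLp.smul_apply, smul_eq_mul]
        push_cast
        field_simp
      · intro k _ hk
        have : (k : ℕ) ≠ j := fun h => hk (Fin.ext h)
        simp [rectDiagonal, this]
      · simp
  let U : Matrix (Fin m) (Fin m) 𝕜 := Matrix.of fun i k => (u k).ofLp i
  let V : Matrix (Fin n) (Fin n) 𝕜 := Matrix.of fun i k => (v k).ofLp i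
  have hU : U.conjTranspose * U = 1 := by
    ext i k
    have := orthonormal_iff_ite.mp u.orthonormal i k
    rw [EuclideanSpace.inner_eq_star_dotProduct] at this
    simp only [Matrix.mul_apply, Matrix.conjTranspose_apply, U, Matrix.of_apply, Matrix.one_apply]
    rw [← this]
    simp [dotProduct, mul_comm]
  have hV : V.conjTranspose * V = 1 := by
    ext i k
    have := orthonormal_iff_ite.mp v.orthonormal i k
    rw [EuclideanSpace.inner_eq_star_dotProduct] at this
    simp only [Matrix.mul_apply, Matrix.conjTranspose_apply, V, Matrix.of_apply, Matrix.one_apply]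
    rw [← this]
    simp [dotProduct, mul_comm]
  have hAV : A * V = U * rectDiagonal 𝕜 m n (singularValue A) := by
    ext i j
    have := hTv j i
    rw [show (T (v j)).ofLp i = A.mulVec (v j).ofLp i from rfl] at this
    simpa [Matrix.mul_apply, Matrix.mulVec, dotProduct, U, V] using this
  refine ⟨U, V, Matrix.mem_unitaryGroup_iff'.mpr hU, Matrix.mem_unitaryGroup_iff'.mpr hV, ?_⟩
  rw [← hAV, Matrix.mul_assoc, mul_eq_one_comm.mp hV, Matrix.mul_one]

/-- The singular value functional calculus `𝔖_f(A) = U Σ_{f(φ)} V*`, where `A = U Σ_φ V*` is a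
singular value decomposition. -/
noncomputable def singularValueCalculus (f : ℝ → ℝ) (A : Matrix (Fin m) (Fin n) 𝕜) :
    Matrix (Fin m) (Fin n) 𝕜 :=
  (exists_isSVD A).choose *
    rectDiagonal 𝕜 m n (fun j => f (singularValue A j)) *
    (exists_isSVD A).choose_spec.choose.conjTranspose

/-- When `f 0 = 0`, the matrix `𝔖_f(A)` does not depend on the decomposition that is used. -/
theorem singularValueCalculus_eq_of_isSVD (f : ℝ → ℝ) (hf : f 0 = 0)
    (A : Matrix (Fin m) (Fin n) 𝕜) (U : Matrix (Fin m) (Fin m) 𝕜) (V : Matrix (Fin n) (Fin n) 𝕜)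
    (h : IsSVD A U V) :
    singularValueCalculus f A =
      U * rectDiagonal 𝕜 m n (fun j => f (singularValue A j)) * V.conjTranspose := by
  set U' := (exists_isSVD A).choose with hU'
  set V' := (exists_isSVD A).choose_spec.choose with hV'
  obtain ⟨h1', h2', h3'⟩ : IsSVD A U' V' := (exists_isSVD A).choose_spec.choose_spec
  obtain ⟨h1, h2, h3⟩ := h
  have hUU := Matrix.mem_unitaryGroup_iff'.mp h1
  have hVV := Matrix.mem_unitaryGroup_iff'.mp h2
  have hUU' := Matrix.mem_unitaryGroup_iff'.mp h1'
  have hUU2' := Matrix.mem_unitaryGroup_iff.mp h1'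
  have hVV' := Matrix.mem_unitaryGroup_iff'.mp h2'
  have hVV2 := Matrix.mem_unitaryGroup_iff.mp h2
  have hUU2 := Matrix.mem_unitaryGroup_iff.mp h1
  simp only [Matrix.star_eq_conjTranspose] at hUU hVV hUU' hUU2' hVV' hVV2 hUU2
  set φ := singularValue A with hφ
  set S := rectDiagonal 𝕜 m n φ with hS
  have hφ0 : ∀ j : Fin n, m ≤ j → φ j = 0 := fun j hj =>
    singularValue_eq_zero A ((min_le_left _ _).trans hj)
  have hφ1 : ∀ j, 0 ≤ φ j := fun j => LinearMap.singularValues_nonneg _ j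
  set P := U'.conjTranspose * U with hP
  set Q := V'.conjTranspose * V with hQ
  have hPS : P * S = S * Q := by
    calc P * S = U'.conjTranspose * (U * S * V.conjTranspose) * V := by
          simp only [hP, Matrix.mul_assoc, hVV, Matrix.mul_one]
      _ = U'.conjTranspose * (U' * S * V'.conjTranspose) * V := by rw [← h3, ← h3']
      _ = (U'.conjTranspose * U') * S * Q := by simp only [hQ, Matrix.mul_assoc]
      _ = S * Q := by rw [hUU', Matrix.one_mul]
  have hQS : Q * S.conjTranspose = S.conjTranspose * P := by
    have e : (U * S * V.conjTranspose).conjTranspose = (U' * S * V'.conjTranspose).conjTranspose := by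
      rw [← h3, ← h3']
    simp only [Matrix.conjTranspose_mul, Matrix.conjTranspose_conjTranspose] at e
    calc Q * S.conjTranspose
        = V'.conjTranspose * (V * (S.conjTranspose * U.conjTranspose)) * U := by
          simp only [hQ, Matrix.mul_assoc, hUU, Matrix.mul_one]
      _ = (V'.conjTranspose * V') * S.conjTranspose * P := by
          rw [e]; simp only [hP, Matrix.mul_assoc]
      _ = S.conjTranspose * P := by rw [hVV', Matrix.one_mul]
  have hSS : S.conjTranspose * S = Matrix.diagonal fun j : Fin n => ((φ j ^ 2 : ℝ) : 𝕜) := by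
    ext i j
    rw [Matrix.mul_apply, Matrix.diagonal_apply]
    simp only [hS, rectDiagonal, Matrix.conjTranspose_apply, Matrix.of_apply]
    by_cases hi : (i : ℕ) < m
    · rw [Finset.sum_eq_single (⟨i, hi⟩ : Fin m)]
      · by_cases hij : i = j
        · subst hij
          simp [pow_two]
        · have : (i : ℕ) ≠ j := fun h => hij (Fin.ext h)
          simp [hij, this]
      · intro k _ hk
        have : (k : ℕ) ≠ i := fun h => hk (Fin.ext h)
        simp [this]
      · simp
    · have h0 := hφ0 i (not_lt.mp hi)
      rw [Finset.sum_eq_zero]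
      · split_ifs with hij
        · simp [h0]
        · rfl
      · intro k _
        simp [h0]
  have hcomm : Q * (S.conjTranspose * S) = (S.conjTranspose * S) * Q := by
    rw [← Matrix.mul_assoc, hQS, Matrix.mul_assoc, hPS, Matrix.mul_assoc]
  have hQφ : ∀ i j : Fin n, Q i j ≠ 0 → φ i = φ j := by
    intro i j hne
    have e := congrFun (congrFun hcomm i) j
    rw [hSS, Matrix.mul_diagonal, Matrix.diagonal_mul, mul_comm] at e
    have e2 : ((φ j ^ 2 : ℝ) : 𝕜) = ((φ i ^ 2 : ℝ) : 𝕜) := mul_right_cancel₀ hne e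
    have e3 : φ j ^ 2 = φ i ^ 2 := by exact_mod_cast e2
    exact ((pow_left_inj₀ (hφ1 _) (hφ1 _) two_ne_zero).mp e3).symm
  set D : Matrix (Fin n) (Fin n) 𝕜 :=
    Matrix.diagonal fun j : Fin n => ((f (φ j) / φ j : ℝ) : 𝕜) with hD
  have hQD : Q * D = D * Q := by
    ext i j
    rw [hD, Matrix.mul_diagonal, Matrix.diagonal_mul]
    by_cases hne : Q i j = 0
    · simp [hne]
    · rw [hQφ i j hne, mul_comm]
  have hSD : rectDiagonal 𝕜 m n (fun j => f (φ j)) = S * D := by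
    ext i j
    rw [hD, Matrix.mul_diagonal]
    simp only [hS, rectDiagonal, Matrix.of_apply]
    split_ifs with hij
    · by_cases h0 : φ j = 0
      · simp [h0, hf]
      · rw [← RCLike.ofReal_mul, mul_div_cancel₀ _ h0]
    · simp
  change U' * rectDiagonal 𝕜 m n (fun j => f (φ j)) * V'.conjTranspose = _
  rw [hSD]
  calc U' * (S * D) * V'.conjTranspose
      = U' * (S * D) * V'.conjTranspose * (V * V.conjTranspose) := by rw [hVV2, Matrix.mul_one]
    _ = U' * (S * (D * Q)) * V.conjTranspose := by simp only [hQ, Matrix.mul_assoc]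
    _ = U' * ((S * Q) * D) * V.conjTranspose := by rw [← hQD]; simp only [Matrix.mul_assoc]
    _ = (U' * U'.conjTranspose) * U * (S * D) * V.conjTranspose := by
        rw [← hPS]; simp only [hP, Matrix.mul_assoc]
    _ = U * (S * D) * V.conjTranspose := by rw [hUU2', Matrix.one_mul]

/-- The hard threshold `f₀`: `x ↦ 0` for `x < σ₀` and `x ↦ x` for `σ₀ ≤ x`. -/
noncomputable def hardThreshold (σ₀ x : ℝ) : ℝ := if x < σ₀ then 0 else x

end SingularValues

/-! ### The objective functional -/

/-- The rank-penalized least-squares functional `N_F(X) = σ₀² rank X + ‖X - F‖²`, with the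
Frobenius norm. -/
noncomputable def rankObjective {𝕜 : Type*} [RCLike 𝕜] {m n : ℕ} (σ₀ : ℝ)
    (F X : Matrix (Fin m) (Fin n) 𝕜) : EReal :=
  ((σ₀ ^ 2 * (X.rank : ℝ) + ‖X - F‖ ^ 2 : ℝ) : EReal)

/-! The dual function g(Λ) = min_X (N(X) + Re⟨X, Λ⟩) = -N*(-Λ) is concave, and any Lagrangian
minimizer `S Λ` is a supergradient at Λ. The iteration is therefore projected supergradient ascent
for g on Mᗮ. Since `S Λ` stays within a fixed distance of F - Λ/2, each step contracts Λ up to a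
bounded term, so all iterates are bounded and subsequences converge. The telescoped supergradient
estimate and the step-size condition make the best dual values approach sup g over Mᗮ, so a limit Λs
is dual optimal (`dualValue_le_of_tendsto`).

If the Lagrangian at Λs has only one minimizer, the limit Xs is that minimizer, and dual optimality
kills its component in Mᗮ (`mem_of_isMax_dualValue`). Then N**(Xs) ≤ N(Xs) = g(Λs) ≤ N**(X) for
every X in M, by weak duality.

It remains to minimize σ₀² rank X + ‖X - A‖² with A = F - Λ/2. Unitary invariance reduces A to a
diagonal D with entries φ i. If P projects onto the column space of X and p i = P i i, the cost is
‖X - PD‖² + ∑ (φ i² (1 - p i) + σ₀² p i) (`rank_penalty_rectDiagonal_eq`). As p i lies in [0, 1],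
hard thresholding is optimal, and it is the only optimum when no singular value equals σ₀. -/

section DualAscent

variable {𝕜 E : Type*} [RCLike 𝕜] [NormedAddCommGroup E] [InnerProductSpace 𝕜 E]

/-- `S Λ` minimizes the Lagrangian `X ↦ N X + Re ⟨X, Λ⟩`, for every multiplier `Λ`. -/
def IsLagrangianMinimizer (𝕜 : Type*) {E : Type*} [RCLike 𝕜] [NormedAddCommGroup E]
    [InnerProductSpace 𝕜 E] (N : E → ℝ) (S : E → E) : Prop :=
  ∀ Λ X, N (S Λ) + RCLike.re (inner 𝕜 (S Λ) Λ) ≤ N X + RCLike.re (inner 𝕜 X Λ)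

/-- The value of the Lagrangian dual function, when `S` selects minimizers. -/
noncomputable def dualValue (𝕜 : Type*) {E : Type*} [RCLike 𝕜] [NormedAddCommGroup E]
    [InnerProductSpace 𝕜 E] (N : E → ℝ) (S : E → E) (Λ : E) : ℝ :=
  N (S Λ) + RCLike.re (inner 𝕜 (S Λ) Λ)

/-! ### Weak duality and supergradients of the dual function. -/

variable {N : E → ℝ} {S : E → E}

theorem fenchelConjugate_neg_eq (hS : IsLagrangianMinimizer 𝕜 N S) (Λ : E) :
    fenchelConjugate 𝕜 (fun X => (N X : EReal)) (-Λ) = ((-dualValue 𝕜 N S Λ : ℝ) : EReal) := by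
  refine le_antisymm (iSup_le fun X => ?_) (le_iSup_of_le (S Λ) ?_)
  · rw [← EReal.coe_sub, EReal.coe_le_coe_iff, inner_neg_right, map_neg]
    have := hS Λ X
    unfold dualValue
    linarith
  · rw [← EReal.coe_sub, EReal.coe_le_coe_iff, inner_neg_right, map_neg]
    unfold dualValue
    linarith

/-- `S Λ` competes in the minimization at Λ', and the Lagrangian is affine in the multiplier. Thus
`S Λ` is a supergradient of the dual function at Λ. -/
theorem dualValue_le_add_inner (hS : IsLagrangianMinimizer 𝕜 N S) (Λ Λ' : E) :
    dualValue 𝕜 N S Λ' ≤ dualValue 𝕜 N S Λ + RCLike.re (inner 𝕜 (S Λ) (Λ' - Λ)) := by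
  have := hS Λ' (S Λ)
  rw [inner_sub_right, map_sub]
  unfold dualValue
  linarith

theorem fenchelBiconjugate_coe_le (N : E → ℝ) (X : E) :
    fenchelBiconjugate 𝕜 (fun X => (N X : EReal)) X ≤ N X := by
  refine iSup_le fun Y => ?_
  have h : ((RCLike.re (inner 𝕜 X Y) : ℝ) : EReal) - N X ≤
      fenchelConjugate 𝕜 (fun X => (N X : EReal)) Y :=
    le_iSup (fun x : E => ((RCLike.re (inner 𝕜 x Y) : ℝ) : EReal) - N x) X
  rw [← inner_conj_symm, RCLike.conj_re]
  exact EReal.sub_le_of_le_add' ((EReal.sub_le_iff_le_add (.inl (EReal.coe_ne_bot _))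
    (.inl (EReal.coe_ne_top _))).mp h)

/-- The supremum defining the biconjugate is tested at -Λ, where the pairing with X vanishes by
orthogonality. -/
theorem dualValue_le_fenchelBiconjugate (hS : IsLagrangianMinimizer 𝕜 N S) {M : Submodule 𝕜 E}
    {Λ X : E} (hΛ : Λ ∈ Mᗮ) (hX : X ∈ M) :
    (dualValue 𝕜 N S Λ : EReal) ≤ fenchelBiconjugate 𝕜 (fun X => (N X : EReal)) X := by
  refine le_iSup_of_le (-Λ) ?_
  rw [fenchelConjugate_neg_eq hS, ← EReal.coe_sub, EReal.coe_le_coe_iff, inner_neg_left,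
    Submodule.inner_left_of_mem_orthogonal hX hΛ]
  simp

/-! ### Projected supergradient ascent. -/

variable {M : Submodule 𝕜 E}

/-- Here Λ' is the current iterate and Λ a comparison point. Projecting `S Λ'` does not change its
pairing with Λ' - Λ, which lies in Mᗮ, so the cross term is controlled by the supergradient
inequality. -/
theorem norm_sq_dual_step_le [Mᗮ.HasOrthogonalProjection] (hS : IsLagrangianMinimizer 𝕜 N S)
    {a : ℝ} (ha : 0 ≤ a) {Λ Λ' : E} (hΛ : Λ ∈ Mᗮ) (hΛ' : Λ' ∈ Mᗮ) :
    ‖Λ' + (a : 𝕜) • Mᗮ.starProjection (S Λ') - Λ‖ ^ 2 ≤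
      ‖Λ' - Λ‖ ^ 2 - 2 * a * (dualValue 𝕜 N S Λ - dualValue 𝕜 N S Λ') + a ^ 2 * ‖S Λ'‖ ^ 2 := by
  have h1 := dualValue_le_add_inner hS Λ' Λ
  have h2 : inner 𝕜 (Λ' - Λ) (Mᗮ.starProjection (S Λ')) = inner 𝕜 (Λ' - Λ) (S Λ') := by
    rw [← Submodule.inner_starProjection_left_eq_right,
      Submodule.starProjection_eq_self_iff.mpr (Mᗮ.sub_mem hΛ' hΛ)]
  have h3 : ‖Mᗮ.starProjection (S Λ')‖ ^ 2 ≤ ‖S Λ'‖ ^ 2 :=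
    pow_le_pow_left₀ (norm_nonneg _) (Submodule.norm_starProjection_apply_le _ _) 2
  rw [add_sub_right_comm, norm_add_sq (𝕜 := 𝕜), inner_smul_right, h2, norm_smul,
    RCLike.re_ofReal_mul, mul_pow, RCLike.norm_ofReal, sq_abs]
  have h4 : RCLike.re (inner 𝕜 (S Λ') (Λ - Λ')) = - RCLike.re (inner 𝕜 (Λ' - Λ) (S Λ')) := by
    rw [← inner_conj_symm, RCLike.conj_re, ← neg_sub, inner_neg_left, map_neg]
  rw [h4] at h1
  nlinarith [mul_le_mul_of_nonneg_left h1 ha, mul_le_mul_of_nonneg_left h3 (sq_nonneg a)]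

variable {α : ℕ → ℝ} {Λ : ℕ → E}

theorem dual_iterate_mem_orthogonal [Mᗮ.HasOrthogonalProjection] (hΛ0 : Λ 0 = 0)
    (hΛ : ∀ i, Λ (i + 1) = Λ i + (α i : 𝕜) • Mᗮ.starProjection (S (Λ i))) (i : ℕ) :
    Λ i ∈ Mᗮ := by
  induction i with
  | zero => rw [hΛ0]; exact Mᗮ.zero_mem
  | succ i ih =>
    rw [hΛ]
    exact Mᗮ.add_mem ih (Mᗮ.smul_mem _ (Submodule.starProjection_apply_mem _ _))

theorem norm_le_of_shrinkage {F : E} {C : ℝ}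
    (hSC : ∀ Λ, ‖S Λ - (F - ((1 / 2 : ℝ) : 𝕜) • Λ)‖ ≤ C) (Λ : E) :
    ‖S Λ‖ ≤ ‖F‖ + C + ‖Λ‖ / 2 := by
  have h1 : ‖((1 / 2 : ℝ) : 𝕜) • Λ‖ = ‖Λ‖ / 2 := by
    rw [norm_smul, RCLike.norm_ofReal, abs_of_pos (by norm_num)]; ring
  have h2 : ‖S Λ‖ ≤ ‖S Λ - (F - ((1 / 2 : ℝ) : 𝕜) • Λ)‖ + ‖F - ((1 / 2 : ℝ) : 𝕜) • Λ‖ := by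
    simpa using norm_add_le (S Λ - (F - ((1 / 2 : ℝ) : 𝕜) • Λ)) (F - ((1 / 2 : ℝ) : 𝕜) • Λ)
  linarith [norm_sub_le F (((1 / 2 : ℝ) : 𝕜) • Λ), hSC Λ]

theorem norm_dual_iterate_le [Mᗮ.HasOrthogonalProjection] {F : E} {C : ℝ}
    (hSC : ∀ Λ, ‖S Λ - (F - ((1 / 2 : ℝ) : 𝕜) • Λ)‖ ≤ C)
    (hα : ∀ i, 0 < α i ∧ α i ≤ 1) (hΛ0 : Λ 0 = 0)
    (hΛ : ∀ i, Λ (i + 1) = Λ i + (α i : 𝕜) • Mᗮ.starProjection (S (Λ i))) (i : ℕ) :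
    ‖Λ i‖ ≤ 2 * (‖F‖ + C) := by
  have hC : 0 ≤ C := (norm_nonneg _).trans (hSC 0)
  induction i with
  | zero => rw [hΛ0, norm_zero]; positivity
  | succ i ih =>
    obtain ⟨h0, h1⟩ := hα i
    set D := S (Λ i) - (F - ((1 / 2 : ℝ) : 𝕜) • Λ i) with hD
    have hSD : S (Λ i) = (F + D) - ((1 / 2 : ℝ) : 𝕜) • Λ i := by rw [hD]; abel
    -- The projection fixes Λ i, so the term -Λ/2 in S shrinks the iterate by the factor 1 - α i /
    -- 2. The radius 2(‖F‖ + C) is the fixed point of r ↦ (1 - a/2) r + a (‖F‖ + C).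
    have hstep : Λ (i + 1) =
        ((1 - α i / 2 : ℝ) : 𝕜) • Λ i + (α i : 𝕜) • Mᗮ.starProjection (F + D) := by
      rw [hΛ, hSD, map_sub, map_smul,
        Submodule.starProjection_eq_self_iff.mpr (dual_iterate_mem_orthogonal hΛ0 hΛ i)]
      push_cast
      module
    have hP : ‖Mᗮ.starProjection (F + D)‖ ≤ ‖F‖ + C :=
      (Submodule.norm_starProjection_apply_le _ _).trans
        ((norm_add_le _ _).trans (add_le_add_right (hSC _) _))
    calc ‖Λ (i + 1)‖ ≤ (1 - α i / 2) * ‖Λ i‖ + α i * ‖Mᗮ.starProjection (F + D)‖ := by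
          rw [hstep]
          refine (norm_add_le _ _).trans (le_of_eq ?_)
          rw [norm_smul, norm_smul, RCLike.norm_ofReal, RCLike.norm_ofReal, abs_of_pos h0,
            abs_of_nonneg (by linarith)]
      _ ≤ (1 - α i / 2) * (2 * (‖F‖ + C)) + α i * (‖F‖ + C) :=
          add_le_add (mul_le_mul_of_nonneg_left ih (by linarith))
            (mul_le_mul_of_nonneg_left hP h0.le)
      _ = 2 * (‖F‖ + C) := by ring

/-- Telescoping of `norm_sq_dual_step_le`. The sums start at index 1, as in the step-size condition,
so the initial distance is measured from Λ 1. -/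
theorem sum_dual_gap_le [Mᗮ.HasOrthogonalProjection] (hS : IsLagrangianMinimizer 𝕜 N S)
    (hα : ∀ i, 0 < α i) (hΛ0 : Λ 0 = 0)
    (hΛ : ∀ i, Λ (i + 1) = Λ i + (α i : 𝕜) • Mᗮ.starProjection (S (Λ i)))
    {B : ℝ} (hB : ∀ i, ‖S (Λ i)‖ ≤ B) {Λ' : E} (hΛ' : Λ' ∈ Mᗮ) (K : ℕ) :
    ‖Λ (K + 1) - Λ'‖ ^ 2 +
      ∑ i ∈ Finset.Icc 1 K, 2 * α i * (dualValue 𝕜 N S Λ' - dualValue 𝕜 N S (Λ i)) ≤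
      ‖Λ 1 - Λ'‖ ^ 2 + B ^ 2 * ∑ i ∈ Finset.Icc 1 K, α i ^ 2 := by
  induction K with
  | zero => simp
  | succ K ih =>
    have h := norm_sq_dual_step_le hS (hα (K + 1)).le hΛ'
      (dual_iterate_mem_orthogonal hΛ0 hΛ (K + 1))
    rw [← hΛ] at h
    rw [Finset.sum_Icc_succ_top (by omega), Finset.sum_Icc_succ_top (by omega), mul_add]
    have h2 : α (K + 1) ^ 2 * ‖S (Λ (K + 1))‖ ^ 2 ≤ α (K + 1) ^ 2 * B ^ 2 :=
      mul_le_mul_of_nonneg_left (pow_le_pow_left₀ (norm_nonneg _) (hB _) 2) (sq_nonneg _)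
    linarith

/-- The numerator never falls below α 1 ² > 0 once K ≥ 1, so a vanishing ratio forces the
denominator to diverge. -/
theorem tendsto_sum_atTop_of_ratio (hα : ∀ i, 0 < α i)
    (hlim : Tendsto (fun K : ℕ => (∑ i ∈ Finset.Icc 1 K, α i ^ 2) / ∑ i ∈ Finset.Icc 1 K, α i)
      atTop (𝓝 0)) :
    Tendsto (fun K : ℕ => ∑ i ∈ Finset.Icc 1 K, α i) atTop atTop := by
  have hpos : ∀ K ≥ 1, 0 < ∑ i ∈ Finset.Icc 1 K, α i := fun K hK =>
    Finset.sum_pos (fun i _ => hα i) ⟨1, by simp [hK]⟩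
  have hpos2 : ∀ K ≥ 1, α 1 ^ 2 ≤ ∑ i ∈ Finset.Icc 1 K, α i ^ 2 := fun K hK =>
    Finset.single_le_sum (f := fun i => α i ^ 2) (fun i _ => sq_nonneg _) (by simp [hK])
  have h1 : Tendsto (fun K : ℕ => α 1 ^ 2 * ((∑ i ∈ Finset.Icc 1 K, α i ^ 2) /
      ∑ i ∈ Finset.Icc 1 K, α i)⁻¹) atTop atTop := by
    refine Tendsto.const_mul_atTop (pow_pos (hα 1) 2) (Tendsto.inv_tendsto_nhdsGT_zero ?_)
    refine tendsto_nhdsWithin_iff.mpr ⟨hlim, ?_⟩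
    filter_upwards [eventually_ge_atTop 1] with K hK
    exact div_pos ((pow_pos (hα 1) 2).trans_le (hpos2 K hK)) (hpos K hK)
  refine tendsto_atTop_mono' _ ?_ h1
  filter_upwards [eventually_ge_atTop 1] with K hK
  have h2 := (pow_pos (hα 1) 2).trans_le (hpos2 K hK)
  rw [inv_div, ← mul_div_assoc, div_le_iff₀ h2, mul_comm]
  exact mul_le_mul_of_nonneg_left (hpos2 K hK) (hpos K hK).le

theorem dualValue_le_of_tendsto [Mᗮ.HasOrthogonalProjection] (hS : IsLagrangianMinimizer 𝕜 N S)
    (hα : ∀ i, 0 < α i)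
    (hlim : Tendsto (fun K : ℕ => (∑ i ∈ Finset.Icc 1 K, α i ^ 2) / ∑ i ∈ Finset.Icc 1 K, α i)
      atTop (𝓝 0))
    (hΛ0 : Λ 0 = 0)
    (hΛ : ∀ i, Λ (i + 1) = Λ i + (α i : 𝕜) • Mᗮ.starProjection (S (Λ i)))
    {B : ℝ} (hB : ∀ i, ‖S (Λ i)‖ ≤ B) {ν : ℕ → ℕ}
    (hν : ∀ k, ∀ i ≤ k, dualValue 𝕜 N S (Λ i) ≤ dualValue 𝕜 N S (Λ (ν k)))
    {κ : ℕ → ℕ} (hκ : StrictMono κ) {Λs : E} (hΛs : Tendsto (fun j => Λ (ν (κ j))) atTop (𝓝 Λs))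
    {Λ' : E} (hΛ' : Λ' ∈ Mᗮ) :
    dualValue 𝕜 N S Λ' ≤ dualValue 𝕜 N S Λs := by
  set A : ℕ → ℝ := fun K => ∑ i ∈ Finset.Icc 1 K, α i with hA
  set Q : ℕ → ℝ := fun K => ∑ i ∈ Finset.Icc 1 K, α i ^ 2 with hQ
  have hApos : ∀ K ≥ 1, 0 < A K := fun K hK => Finset.sum_pos (fun i _ => hα i) ⟨1, by simp [hK]⟩
  have hgap : ∀ K ≥ 1, dualValue 𝕜 N S Λ' ≤ dualValue 𝕜 N S (Λ (ν K)) +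
      (‖Λ 1 - Λ'‖ ^ 2 / A K + B ^ 2 * (Q K / A K)) / 2 := by
    intro K hK
    have h1 := sum_dual_gap_le hS hα hΛ0 hΛ hB hΛ' K
    have h2 : 2 * (dualValue 𝕜 N S Λ' - dualValue 𝕜 N S (Λ (ν K))) * A K ≤
        ∑ i ∈ Finset.Icc 1 K, 2 * α i * (dualValue 𝕜 N S Λ' - dualValue 𝕜 N S (Λ i)) := by
      rw [hA, Finset.mul_sum]
      refine Finset.sum_le_sum fun i hi => ?_
      nlinarith [hν K i (Finset.mem_Icc.mp hi).2, hα i]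
    have h3 : 2 * (dualValue 𝕜 N S Λ' - dualValue 𝕜 N S (Λ (ν K))) ≤
        (‖Λ 1 - Λ'‖ ^ 2 + B ^ 2 * Q K) / A K := by
      rw [le_div_iff₀ (hApos K hK)]
      linarith [sq_nonneg ‖Λ (K + 1) - Λ'‖]
    rw [add_div, mul_div_assoc] at h3
    linarith
  have hAtop := tendsto_sum_atTop_of_ratio hα hlim
  have herr : Tendsto (fun K => (‖Λ 1 - Λ'‖ ^ 2 / A K + B ^ 2 * (Q K / A K)) / 2) atTop (𝓝 0) := by
    simpa using ((hAtop.const_div_atTop (‖Λ 1 - Λ'‖ ^ 2)).add (hlim.const_mul (B ^ 2))).div_const 2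
  -- The supergradient inequality at Λs supplies the upper semicontinuity of the dual function that
  -- the limit needs.
  have hin : Tendsto (fun j => RCLike.re (inner 𝕜 (S Λs) (Λ (ν (κ j)) - Λs))) atTop (𝓝 0) := by
    have h : Tendsto (fun j => Λ (ν (κ j)) - Λs) atTop (𝓝 0) := by
      simpa using hΛs.sub_const Λs
    have h2 : Tendsto (fun j => inner 𝕜 (S Λs) (Λ (ν (κ j)) - Λs)) atTop (𝓝 (inner 𝕜 (S Λs) 0)) :=
      tendsto_const_nhds.inner h
    simpa [Function.comp_def] using (RCLike.continuous_re.tendsto _).comp h2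
  have hlim2 : Tendsto (fun j => dualValue 𝕜 N S Λs +
      RCLike.re (inner 𝕜 (S Λs) (Λ (ν (κ j)) - Λs)) +
      (‖Λ 1 - Λ'‖ ^ 2 / A (κ j) + B ^ 2 * (Q (κ j) / A (κ j))) / 2) atTop
      (𝓝 (dualValue 𝕜 N S Λs)) := by
    simpa using (hin.const_add (dualValue 𝕜 N S Λs)).add (herr.comp hκ.tendsto_atTop)
  refine ge_of_tendsto hlim2 ?_
  filter_upwards [eventually_ge_atTop 1] with j hj
  have := hgap (κ j) (hj.trans hκ.le_apply)
  linarith [dualValue_le_add_inner hS Λs (Λ (ν (κ j)))]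

/-! ### Limits of minimizers and primal feasibility. -/

/-- A limit of Lagrangian minimizers is a Lagrangian minimizer, for a lower semicontinuous
objective. -/
theorem lagrangian_le_of_tendsto (hN : LowerSemicontinuous N) (hS : IsLagrangianMinimizer 𝕜 N S)
    {L : ℕ → E} {Ls Xs : E} (hL : Tendsto L atTop (𝓝 Ls))
    (hX : Tendsto (fun j => S (L j)) atTop (𝓝 Xs)) (Y : E) :
    N Xs + RCLike.re (inner 𝕜 Xs Ls) ≤ N Y + RCLike.re (inner 𝕜 Y Ls) := by
  have h1 : Tendsto (fun j => N Y + RCLike.re (inner 𝕜 Y (L j)) -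
      RCLike.re (inner 𝕜 (S (L j)) (L j))) atTop
      (𝓝 (N Y + RCLike.re (inner 𝕜 Y Ls) - RCLike.re (inner 𝕜 Xs Ls))) := by
    refine Tendsto.sub (Tendsto.const_add _ ?_) ?_
    · exact (RCLike.continuous_re.tendsto _).comp (tendsto_const_nhds.inner hL)
    · exact (RCLike.continuous_re.tendsto _).comp (hX.inner hL)
  suffices N Xs ≤ N Y + RCLike.re (inner 𝕜 Y Ls) - RCLike.re (inner 𝕜 Xs Ls) by linarith
  refine le_of_forall_lt fun c hc => ?_
  obtain ⟨c', hc', hc''⟩ := exists_between hc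
  refine hc'.trans_le (ge_of_tendsto h1 ?_)
  filter_upwards [hX.eventually (hN Xs c' hc'')] with j hj
  linarith [hS (L j) Y]

/-- At a multiplier with a unique Lagrangian minimizer, dual optimality over `Mᗮ` forces the
minimizer to lie in `M`. -/
theorem mem_of_isMax_dualValue [FiniteDimensional 𝕜 E] (hN : LowerSemicontinuous N)
    (hS : IsLagrangianMinimizer 𝕜 N S) {F : E} {C : ℝ}
    (hSC : ∀ Λ, ‖S Λ - (F - ((1 / 2 : ℝ) : 𝕜) • Λ)‖ ≤ C) {Λs Xs : E} (hΛs : Λs ∈ Mᗮ)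
    (hmax : ∀ Λ ∈ Mᗮ, dualValue 𝕜 N S Λ ≤ dualValue 𝕜 N S Λs)
    (huniq : ∀ X, (∀ Y, N X + RCLike.re (inner 𝕜 X Λs) ≤ N Y + RCLike.re (inner 𝕜 Y Λs)) →
      X = Xs) :
    Xs ∈ M := by
  have : ProperSpace E := FiniteDimensional.proper 𝕜 E
  -- The multiplier is perturbed to Λs + D/(k+1). Maximality at Λs and the supergradient inequality
  -- at the perturbed point give the sign of the pairing of D with the minimizer there. Compactness
  -- and uniqueness carry the sign over to Xs.
  have key : ∀ D ∈ Mᗮ, RCLike.re (inner 𝕜 Xs D) ≤ 0 := by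
    intro D hD
    set L : ℕ → E := fun k => Λs + ((1 / ((k : ℝ) + 1) : ℝ) : 𝕜) • D with hLdef
    have hL : Tendsto L atTop (𝓝 Λs) := by
      have h : Tendsto (fun k : ℕ => ((1 / ((k : ℝ) + 1) : ℝ) : 𝕜)) atTop (𝓝 ((0 : ℝ) : 𝕜)) :=
        (RCLike.continuous_ofReal.tendsto _).comp tendsto_one_div_add_atTop_nhds_zero_nat
      simpa [hLdef] using (h.smul_const D).const_add Λs
    have hle : ∀ k, RCLike.re (inner 𝕜 (S (L k)) D) ≤ 0 := by
      intro k
      have h1 := dualValue_le_add_inner hS (L k) Λs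
      have h2 := hmax (L k) (Mᗮ.add_mem hΛs (Mᗮ.smul_mem _ hD))
      have h3 : Λs - L k = -(((1 / ((k : ℝ) + 1) : ℝ) : 𝕜) • D) := by simp [hLdef]
      rw [h3, inner_neg_right, inner_smul_right, map_neg, RCLike.re_ofReal_mul] at h1
      have h4 : (0 : ℝ) < 1 / ((k : ℝ) + 1) := by positivity
      by_contra hc
      nlinarith [mul_pos h4 (not_le.mp hc)]
    obtain ⟨R, hR⟩ := (Metric.isBounded_range_of_tendsto L hL).exists_norm_le
    have hbdd : ∀ k, S (L k) ∈ Metric.closedBall (0 : E) (‖F‖ + C + R / 2) := by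
      intro k
      rw [mem_closedBall_zero_iff]
      have := norm_le_of_shrinkage hSC (L k)
      have := hR (L k) (Set.mem_range_self k)
      linarith
    obtain ⟨X', -, φ, hφ, hX'⟩ := (isCompact_closedBall _ _).tendsto_subseq hbdd
    have hXX : X' = Xs :=
      huniq X' (lagrangian_le_of_tendsto hN hS (hL.comp hφ.tendsto_atTop) hX')
    rw [← hXX]
    have h5 : Tendsto (fun j => RCLike.re (inner 𝕜 (S (L (φ j))) D)) atTop
        (𝓝 (RCLike.re (inner 𝕜 X' D))) :=
      (RCLike.continuous_re.tendsto _).comp (hX'.inner tendsto_const_nhds)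
    exact le_of_tendsto h5 (Eventually.of_forall fun j => hle (φ j))
  -- A one-sided bound suffices: for this D the pairing is ‖D‖².
  set D := Mᗮ.starProjection Xs with hD
  have h1 := key D (Submodule.starProjection_apply_mem _ _)
  have h2 : inner 𝕜 Xs D = inner 𝕜 D D := by
    rw [hD, Submodule.inner_starProjection_left_eq_right,
      Submodule.starProjection_eq_self_iff.mpr (Submodule.starProjection_apply_mem _ _)]
  rw [h2, inner_self_eq_norm_sq] at h1
  have h3 : D = 0 := by
    rw [← norm_eq_zero]
    exact pow_eq_zero_iff two_ne_zero |>.mp (le_antisymm h1 (sq_nonneg _))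
  rw [← M.orthogonal_orthogonal]
  exact (Submodule.starProjection_apply_eq_zero_iff _).mp h3

/-- S need not be continuous: a limit of minimizers minimizes the limiting Lagrangian by lower
semicontinuity, and uniqueness then identifies Xs with `S Λs`. -/
theorem dual_ascent_best_iterate [FiniteDimensional 𝕜 E]
    (hN : LowerSemicontinuous N)
    (hS : IsLagrangianMinimizer 𝕜 N S) {F : E} {C : ℝ}
    (hSC : ∀ Λ, ‖S Λ - (F - ((1 / 2 : ℝ) : 𝕜) • Λ)‖ ≤ C)
    (hα : ∀ i, 0 < α i ∧ α i ≤ 1)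
    (hlim : Tendsto (fun K : ℕ => (∑ i ∈ Finset.Icc 1 K, α i ^ 2) / ∑ i ∈ Finset.Icc 1 K, α i)
      atTop (𝓝 0))
    (hΛ0 : Λ 0 = 0)
    (hΛ : ∀ i, Λ (i + 1) = Λ i + (α i : 𝕜) • Mᗮ.starProjection (S (Λ i))) {ν : ℕ → ℕ}
    (hν : ∀ k, ∀ i ≤ k, dualValue 𝕜 N S (Λ i) ≤ dualValue 𝕜 N S (Λ (ν k))) :
    (∃ (κ : ℕ → ℕ) (Xs Λs : E), StrictMono κ ∧
      Tendsto (fun j => S (Λ (ν (κ j)))) atTop (𝓝 Xs) ∧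
      Tendsto (fun j => Λ (ν (κ j))) atTop (𝓝 Λs)) ∧
    ∀ (κ : ℕ → ℕ) (Xs Λs : E), StrictMono κ →
      Tendsto (fun j => S (Λ (ν (κ j)))) atTop (𝓝 Xs) →
      Tendsto (fun j => Λ (ν (κ j))) atTop (𝓝 Λs) →
      (∀ X, (∀ Y, N X + RCLike.re (inner 𝕜 X Λs) ≤ N Y + RCLike.re (inner 𝕜 Y Λs)) →
        X = S Λs) →
      Xs ∈ M ∧ IsMinOn (fenchelBiconjugate 𝕜 fun X => (N X : EReal)) M Xs := by
  have : ProperSpace E := FiniteDimensional.proper 𝕜 E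
  have hΛb := norm_dual_iterate_le hSC hα hΛ0 hΛ
  have hSb : ∀ i, ‖S (Λ i)‖ ≤ 2 * (‖F‖ + C) := fun i => by
    linarith [norm_le_of_shrinkage hSC (Λ i), hΛb i]
  refine ⟨?_, fun κ Xs Λs hκ hX hL huniq => ?_⟩
  · obtain ⟨⟨Xs, Λs⟩, -, κ, hκ, h⟩ :=
      ((isCompact_closedBall (0 : E) (2 * (‖F‖ + C))).prod
        (isCompact_closedBall (0 : E) (2 * (‖F‖ + C)))).tendsto_subseq
        (x := fun k => (S (Λ (ν k)), Λ (ν k)))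
        (fun k => ⟨mem_closedBall_zero_iff.mpr (hSb _), mem_closedBall_zero_iff.mpr (hΛb _)⟩)
    exact ⟨κ, Xs, Λs, hκ, (continuous_fst.tendsto _).comp h, (continuous_snd.tendsto _).comp h⟩
  · have hXmin := lagrangian_le_of_tendsto hN hS hL hX
    have hXS := huniq Xs hXmin
    have hΛs : Λs ∈ Mᗮ := (Submodule.isClosed_orthogonal M).mem_of_tendsto hL
      (Eventually.of_forall fun j => dual_iterate_mem_orthogonal hΛ0 hΛ _)
    have hXM : Xs ∈ M := mem_of_isMax_dualValue hN hS hSC hΛs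
      (fun Λ' hΛ' => dualValue_le_of_tendsto hS (fun i => (hα i).1) hlim hΛ0 hΛ hSb hν hκ hL hΛ')
      (fun X hX => (huniq X hX).trans hXS.symm)
    refine ⟨hXM, fun X hXm => ?_⟩
    -- N**(Xs) ≤ N(Xs) = g(Λs) ≤ N**(X); the equality holds because Xs in M is orthogonal to Λs.
    refine (fenchelBiconjugate_coe_le N Xs).trans
      (le_trans (le_of_eq ?_) (dualValue_le_fenchelBiconjugate hS hΛs hXm))
    rw [dualValue, ← hXS, Submodule.inner_right_of_mem_orthogonal hXM hΛs]
    simp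

end DualAscent

/-! ### Frobenius geometry, unitary invariance and semicontinuity of the rank. -/

section RankPenalty

open Matrix

variable {𝕜 : Type*} [RCLike 𝕜] {m n : ℕ}

theorem frobenius_inner_eq_trace (A B : Matrix (Fin m) (Fin n) 𝕜) :
    inner 𝕜 A B = (Aᴴ * B).trace := by
  change ∑ i, ∑ j, inner 𝕜 (A i j) (B i j) = _
  simp only [Matrix.trace, Matrix.diag_apply, Matrix.mul_apply, Matrix.conjTranspose_apply]
  rw [Finset.sum_comm]
  simp [mul_comm]

theorem frobenius_norm_sq_eq_trace (A : Matrix (Fin m) (Fin n) 𝕜) :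
    ‖A‖ ^ 2 = RCLike.re (Aᴴ * A).trace := by
  rw [← frobenius_inner_eq_trace, inner_self_eq_norm_sq]

theorem frobenius_norm_sq_eq_trace_mul_conjTranspose (A : Matrix (Fin m) (Fin n) 𝕜) :
    ‖A‖ ^ 2 = RCLike.re (A * Aᴴ).trace := by
  rw [frobenius_norm_sq_eq_trace, Matrix.trace_mul_comm]

theorem frobenius_norm_sq_add_of_conjTranspose_mul_eq_zero {A B : Matrix (Fin m) (Fin n) 𝕜}
    (h : Aᴴ * B = 0) : ‖A + B‖ ^ 2 = ‖A‖ ^ 2 + ‖B‖ ^ 2 := by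
  rw [norm_add_sq (𝕜 := 𝕜), frobenius_inner_eq_trace, h]
  simp

theorem frobenius_norm_sq_unitary_mul {U : Matrix (Fin m) (Fin m) 𝕜}
    {V : Matrix (Fin n) (Fin n) 𝕜} (hU : U ∈ unitaryGroup (Fin m) 𝕜)
    (hV : V ∈ unitaryGroup (Fin n) 𝕜) (A : Matrix (Fin m) (Fin n) 𝕜) :
    ‖U * A * Vᴴ‖ ^ 2 = ‖A‖ ^ 2 := by
  have hU' : Uᴴ * U = 1 := mem_unitaryGroup_iff'.mp hU
  have hV' : Vᴴ * V = 1 := mem_unitaryGroup_iff'.mp hV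
  rw [frobenius_norm_sq_eq_trace, frobenius_norm_sq_eq_trace]
  have h : (U * A * Vᴴ)ᴴ * (U * A * Vᴴ) = V * (Aᴴ * (Uᴴ * U) * A) * Vᴴ := by
    simp only [conjTranspose_mul, conjTranspose_conjTranspose, Matrix.mul_assoc]
  rw [h, hU', Matrix.mul_one, Matrix.trace_mul_comm, ← Matrix.mul_assoc, hV', Matrix.one_mul]

theorem rank_unitary_mul {U : Matrix (Fin m) (Fin m) 𝕜}
    {V : Matrix (Fin n) (Fin n) 𝕜} (hU : U ∈ unitaryGroup (Fin m) 𝕜)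
    (hV : V ∈ unitaryGroup (Fin n) 𝕜) (A : Matrix (Fin m) (Fin n) 𝕜) :
    (U * A * Vᴴ).rank = A.rank := by
  have hU' : Uᴴ * U = 1 := mem_unitaryGroup_iff'.mp hU
  have hV' : Vᴴ * V = 1 := mem_unitaryGroup_iff'.mp hV
  rw [rank_mul_eq_left_of_isUnit_det, rank_mul_eq_right_of_isUnit_det]
  · exact isUnit_det_of_left_inverse hU'
  · exact isUnit_det_of_right_inverse hV'

theorem isOpen_setOf_le_matrix_rank (r : ℕ) :
    IsOpen {X : Matrix (Fin m) (Fin n) 𝕜 | r ≤ X.rank} := by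
  let T : Matrix (Fin m) (Fin n) 𝕜 →ₗ[𝕜] (Fin n → 𝕜) →L[𝕜] (Fin m → 𝕜) :=
    LinearMap.toContinuousLinearMap.toLinearMap ∘ₗ (Matrix.toLin').toLinearMap
  have hT : Continuous T := T.continuous_of_finiteDimensional
  convert (isOpen_setOfPred_nat_le_rank (𝕜 := 𝕜) (E := Fin n → 𝕜) (F := Fin m → 𝕜) r).preimage hT
    using 1
  ext X
  have h : LinearMap.rank ((T X : (Fin n → 𝕜) →L[𝕜] (Fin m → 𝕜)) : (Fin n → 𝕜) →ₗ[𝕜] (Fin m → 𝕜)) =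
      (X.rank : Cardinal) := (Module.finrank_eq_rank _ _).symm
  simp only [Set.preimage_ofPred_eq, Set.mem_ofPred_eq, h, Nat.cast_le]

theorem lowerSemicontinuous_rank_penalty (σ₀ : ℝ) (F : Matrix (Fin m) (Fin n) 𝕜) :
    LowerSemicontinuous fun X : Matrix (Fin m) (Fin n) 𝕜 =>
      σ₀ ^ 2 * (X.rank : ℝ) + ‖X - F‖ ^ 2 := by
  refine LowerSemicontinuous.add (fun X y hy => ?_) (Continuous.lowerSemicontinuous ?_)
  · filter_upwards [(isOpen_setOf_le_matrix_rank (𝕜 := 𝕜) (m := m) (n := n) X.rank).mem_nhds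
      (show X.rank ≤ X.rank from le_rfl)]
      with Y hY
    exact hy.trans_le (mul_le_mul_of_nonneg_left (by exact_mod_cast hY) (sq_nonneg _))
  · exact (continuous_id.sub continuous_const).norm.pow 2

/-! ### Column-space projections and their diagonals. -/

/-- The orthogonal projection onto the column space, as a matrix. -/
theorem exists_columnSpace_projection (X : Matrix (Fin m) (Fin n) 𝕜) :
    ∃ P : Matrix (Fin m) (Fin m) 𝕜, Pᴴ = P ∧ P * P = P ∧ P * X = X ∧ P.trace = (X.rank : 𝕜) := by
  obtain ⟨U, V, hU, hV, hX⟩ := exists_isSVD X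
  have hU' : Uᴴ * U = 1 := mem_unitaryGroup_iff'.mp hU
  have hrank : X.rank = Module.finrank 𝕜 (LinearMap.range (toEuclideanLin X)) := by
    rw [Matrix.rank_eq_finrank_range_toLin X (EuclideanSpace.basisFun (Fin m) 𝕜).toBasis
      (EuclideanSpace.basisFun (Fin n) 𝕜).toBasis, toEuclideanLin_eq_toLin_orthonormal]
  have hrm : X.rank ≤ m := X.rank_le_height
  have hσ : ∀ j, X.rank ≤ j → singularValue X j = 0 := fun j hj =>
    (toEuclideanLin X).singularValues_eq_zero_iff_le_finrank_range.mpr (hrank ▸ hj)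
  -- Singular values are sorted, so those with index at least the rank vanish and E fixes the
  -- singular value matrix. The projection is then U E Uᴴ.
  set E : Matrix (Fin m) (Fin m) 𝕜 := diagonal fun i => if (i : ℕ) < X.rank then 1 else 0 with hE
  have hEE : E * E = E := by
    rw [hE, diagonal_mul_diagonal]; congr 1; ext i; split_ifs <;> simp
  have hEH : Eᴴ = E := by
    rw [hE, diagonal_conjTranspose]; congr 1; ext i; simp only [Pi.star_apply]; split_ifs <;> simp
  have hES : E * rectDiagonal 𝕜 m n (singularValue X) = rectDiagonal 𝕜 m n (singularValue X) := by
    ext i j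
    rw [hE, diagonal_mul]
    simp only [rectDiagonal, of_apply]
    by_cases h1 : (i : ℕ) < X.rank
    · simp [h1]
    · by_cases h2 : (i : ℕ) = j
      · simp [hσ j (by omega)]
      · simp [h2]
  refine ⟨U * E * Uᴴ, ?_, ?_, ?_, ?_⟩
  · simp only [conjTranspose_mul, conjTranspose_conjTranspose, hEH, Matrix.mul_assoc]
  · calc U * E * Uᴴ * (U * E * Uᴴ) = U * (E * (Uᴴ * U) * E) * Uᴴ := by
          simp only [Matrix.mul_assoc]
      _ = U * E * Uᴴ := by rw [hU', Matrix.mul_one, hEE]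
  · calc U * E * Uᴴ * X
        = U * (E * (Uᴴ * U) * rectDiagonal 𝕜 m n (singularValue X)) * Vᴴ := by
          conv_lhs => rw [hX]
          simp only [Matrix.mul_assoc]
      _ = X := by rw [hU', Matrix.mul_one, hES, ← hX]
  · rw [Matrix.trace_mul_comm, ← Matrix.mul_assoc, hU', Matrix.one_mul, hE, trace_diagonal,
      Finset.sum_ite, Finset.sum_const_zero, add_zero, Finset.sum_const, nsmul_eq_mul, mul_one]
    congr 1
    rw [Fin.card_filter_val_lt]
    exact min_eq_right hrm

/-- From P = Pᴴ P. This yields both the bounds on the diagonal and the rigidity of columns at the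
values 0 and 1. -/
theorem re_diag_eq_sum_norm_sq {P : Matrix (Fin m) (Fin m) 𝕜} (hP : Pᴴ = P) (hPP : P * P = P)
    (i : Fin m) : RCLike.re (P i i) = ∑ k, ‖P k i‖ ^ 2 := by
  have h : P i i = ∑ k, (starRingEnd 𝕜) (P k i) * P k i := by
    conv_lhs => rw [← hPP]
    rw [Matrix.mul_apply]
    refine Finset.sum_congr rfl fun k _ => ?_
    rw [show P i k = Pᴴ i k by rw [hP]]
    rfl
  rw [h, map_sum]
  refine Finset.sum_congr rfl fun k _ => ?_
  rw [RCLike.conj_mul, ← RCLike.ofReal_pow, RCLike.ofReal_re]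

theorem norm_sq_diag_eq_re_diag_sq {P : Matrix (Fin m) (Fin m) 𝕜} (hP : Pᴴ = P) (i : Fin m) :
    ‖P i i‖ ^ 2 = RCLike.re (P i i) ^ 2 := by
  have h : (starRingEnd 𝕜) (P i i) = P i i := congrFun (congrFun hP i) i
  obtain ⟨r, hr⟩ := RCLike.conj_eq_iff_real.mp h
  rw [hr, RCLike.norm_ofReal, RCLike.ofReal_re, sq_abs]

theorem re_diag_mem_Icc {P : Matrix (Fin m) (Fin m) 𝕜} (hP : Pᴴ = P) (hPP : P * P = P)
    (i : Fin m) : RCLike.re (P i i) ∈ Set.Icc (0 : ℝ) 1 := by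
  have h1 := re_diag_eq_sum_norm_sq hP hPP i
  have h2 : ‖P i i‖ ^ 2 ≤ ∑ k, ‖P k i‖ ^ 2 :=
    Finset.single_le_sum (f := fun k => ‖P k i‖ ^ 2) (fun k _ => sq_nonneg _) (Finset.mem_univ i)
  rw [norm_sq_diag_eq_re_diag_sq hP, ← h1] at h2
  have h0 : 0 ≤ RCLike.re (P i i) := h1 ▸ Finset.sum_nonneg fun k _ => sq_nonneg _
  exact ⟨h0, by nlinarith⟩

theorem column_eq_zero_of_re_diag_eq_zero {P : Matrix (Fin m) (Fin m) 𝕜} (hP : Pᴴ = P)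
    (hPP : P * P = P) {i : Fin m} (hi : RCLike.re (P i i) = 0) (k : Fin m) : P k i = 0 := by
  rw [re_diag_eq_sum_norm_sq hP hPP, Finset.sum_eq_zero_iff_of_nonneg fun k _ => sq_nonneg _] at hi
  simpa using hi k (Finset.mem_univ k)

/-- The complementary projection 1 - P has diagonal entry 0 there. -/
theorem column_eq_of_re_diag_eq_one {P : Matrix (Fin m) (Fin m) 𝕜} (hP : Pᴴ = P)
    (hPP : P * P = P) {i : Fin m} (hi : RCLike.re (P i i) = 1) (k : Fin m) :
    P k i = (1 : Matrix (Fin m) (Fin m) 𝕜) k i := by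
  have hP' : (1 - P)ᴴ = 1 - P := by rw [conjTranspose_sub, hP, conjTranspose_one]
  have hPP' : (1 - P) * (1 - P) = 1 - P := by
    rw [Matrix.sub_mul, Matrix.mul_sub, Matrix.mul_sub, hPP]; simp
  have h := column_eq_zero_of_re_diag_eq_zero hP' hPP' (i := i) (by simp [hi]) k
  rw [Matrix.sub_apply, sub_eq_zero] at h
  exact h.symm

/-! ### Rank-penalized approximation of a diagonal matrix. -/

theorem rectDiagonal_mul_conjTranspose {φ : ℕ → ℝ} (hφ : ∀ i, n ≤ i → φ i = 0) :
    rectDiagonal 𝕜 m n φ * (rectDiagonal 𝕜 m n φ)ᴴ =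
      diagonal fun i : Fin m => ((φ i ^ 2 : ℝ) : 𝕜) := by
  ext i k
  rw [Matrix.mul_apply, diagonal_apply]
  simp only [rectDiagonal, conjTranspose_apply, of_apply]
  by_cases hi : (i : ℕ) < n
  · rw [Finset.sum_eq_single (⟨i, hi⟩ : Fin n)]
    · by_cases hik : i = k
      · subst hik
        simp [pow_two]
      · have : (k : ℕ) ≠ i := fun h => hik (Fin.ext h.symm)
        simp [hik, this]
    · intro j _ hj
      have : (i : ℕ) ≠ j := fun h => hj (Fin.ext h.symm)
      simp [this]
    · simp
  · rw [Finset.sum_eq_zero, hφ i (not_lt.mp hi)]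
    · simp
    · intro j _
      have : (i : ℕ) ≠ j := by omega
      simp [this]

theorem norm_sq_rectDiagonal {φ : ℕ → ℝ} (hφ : ∀ i, n ≤ i → φ i = 0) :
    ‖rectDiagonal 𝕜 m n φ‖ ^ 2 = ∑ i : Fin m, φ i ^ 2 := by
  rw [frobenius_norm_sq_eq_trace_mul_conjTranspose, rectDiagonal_mul_conjTranspose hφ,
    trace_diagonal, map_sum]
  simp only [RCLike.ofReal_re]

theorem norm_sq_projection_mul_rectDiagonal {P : Matrix (Fin m) (Fin m) 𝕜} (hP : Pᴴ = P)
    (hPP : P * P = P) {φ : ℕ → ℝ} (hφ : ∀ i, n ≤ i → φ i = 0) :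
    ‖P * rectDiagonal 𝕜 m n φ‖ ^ 2 = ∑ i : Fin m, RCLike.re (P i i) * φ i ^ 2 := by
  rw [frobenius_norm_sq_eq_trace_mul_conjTranspose, conjTranspose_mul, hP, Matrix.trace_mul_comm,
    Matrix.mul_assoc, ← Matrix.mul_assoc P P, hPP, Matrix.trace_mul_comm, Matrix.mul_assoc,
    rectDiagonal_mul_conjTranspose hφ, Matrix.trace, map_sum]
  refine Finset.sum_congr rfl fun i _ => ?_
  rw [diag_apply, mul_diagonal, mul_comm, RCLike.re_ofReal_mul, mul_comm]

theorem rank_rectDiagonal_le (ψ : ℕ → ℝ) :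
    ((rectDiagonal 𝕜 m n ψ).rank : ℝ) ≤ ∑ i : Fin m, if ψ i = 0 then 0 else 1 := by
  classical
  set w : Fin m → 𝕜 := fun i => if ψ i = 0 then 0 else 1 with hw
  have h : rectDiagonal 𝕜 m n ψ = diagonal w * rectDiagonal 𝕜 m n ψ := by
    ext i j
    rw [diagonal_mul]
    simp only [rectDiagonal, of_apply, hw]
    split_ifs with h1 h2
    · rw [← h1, h2]; simp
    · simp
    · simp
    · simp
  have h2 : (rectDiagonal 𝕜 m n ψ).rank ≤ Fintype.card {i // w i ≠ 0} := by
    rw [h, ← rank_diagonal w]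
    exact rank_mul_le_left _ _
  have h3 : Fintype.card {i // w i ≠ 0} = (Finset.univ.filter fun i : Fin m => ¬ψ i = 0).card := by
    rw [Fintype.card_subtype]
    congr 1
    ext i
    simp [hw]
  calc ((rectDiagonal 𝕜 m n ψ).rank : ℝ)
      ≤ ((Finset.univ.filter fun i : Fin m => ¬ψ i = 0).card : ℝ) := by
        rw [← h3]; exact_mod_cast h2
    _ = ∑ i : Fin m, if ψ i = 0 then (0 : ℝ) else 1 := by
        rw [Finset.sum_ite]; simp

/-- Pythagoras for the column-space projection P of X: X - PD has its columns in the range of P, and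
(1 - P)D in the complement. The rank is the trace of P, so it spreads over the same index set as the
squared entries. -/
theorem rank_penalty_rectDiagonal_eq (σ₀ : ℝ) {φ : ℕ → ℝ} (hφ : ∀ i, n ≤ i → φ i = 0)
    (X : Matrix (Fin m) (Fin n) 𝕜) :
    ∃ P : Matrix (Fin m) (Fin m) 𝕜, Pᴴ = P ∧ P * P = P ∧
      σ₀ ^ 2 * (X.rank : ℝ) + ‖X - rectDiagonal 𝕜 m n φ‖ ^ 2 =
        ‖X - P * rectDiagonal 𝕜 m n φ‖ ^ 2 +
          ∑ i : Fin m, (φ i ^ 2 * (1 - RCLike.re (P i i)) + σ₀ ^ 2 * RCLike.re (P i i)) := by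
  obtain ⟨P, hP, hPP, hPX, htr⟩ := exists_columnSpace_projection X
  refine ⟨P, hP, hPP, ?_⟩
  set D := rectDiagonal 𝕜 m n φ
  have hP' : (1 - P)ᴴ = 1 - P := by rw [conjTranspose_sub, hP, conjTranspose_one]
  have hPP0 : P * (1 - P) = 0 := by rw [Matrix.mul_sub, hPP]; simp
  have hPP' : (1 - P) * (1 - P) = 1 - P := by rw [Matrix.sub_mul, hPP0]; simp
  have h1 : X - D = (X - P * D) + -((1 - P) * D) := by
    rw [Matrix.sub_mul, Matrix.one_mul]; abel
  have h2 : (X - P * D)ᴴ * -((1 - P) * D) = 0 := by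
    have : X - P * D = P * (X - D) := by rw [Matrix.mul_sub, hPX]
    rw [this, conjTranspose_mul, hP, Matrix.mul_neg, Matrix.mul_assoc, ← Matrix.mul_assoc P,
      hPP0]
    simp
  have h3 : (X.rank : ℝ) = ∑ i : Fin m, RCLike.re (P i i) := by
    have := congrArg RCLike.re htr
    rw [Matrix.trace, map_sum, RCLike.natCast_re] at this
    exact this.symm
  rw [h1, frobenius_norm_sq_add_of_conjTranspose_mul_eq_zero h2, norm_neg,
    norm_sq_projection_mul_rectDiagonal hP' hPP' hφ, h3, Finset.mul_sum, Finset.sum_add_distrib,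
    add_left_comm, add_comm (∑ i : Fin m, φ i ^ 2 * _)]
  congr 2
  refine Finset.sum_congr rfl fun i _ => ?_
  simp [mul_comm]

theorem min_le_convexCombination (a b : ℝ) {p : ℝ} (hp : p ∈ Set.Icc (0 : ℝ) 1) :
    min a b ≤ a * (1 - p) + b * p := by
  have h1 := mul_le_mul_of_nonneg_right (min_le_left a b) (sub_nonneg.mpr hp.2)
  have h2 := mul_le_mul_of_nonneg_right (min_le_right a b) hp.1
  linarith

theorem sum_min_le_rank_penalty (σ₀ : ℝ) {φ : ℕ → ℝ} (hφ : ∀ i, n ≤ i → φ i = 0)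
    (X : Matrix (Fin m) (Fin n) 𝕜) :
    ∑ i : Fin m, min (φ i ^ 2) (σ₀ ^ 2) ≤
      σ₀ ^ 2 * (X.rank : ℝ) + ‖X - rectDiagonal 𝕜 m n φ‖ ^ 2 := by
  obtain ⟨P, hP, hPP, h⟩ := rank_penalty_rectDiagonal_eq σ₀ hφ X
  rw [h]
  have := Finset.sum_le_sum fun (i : Fin m) (_ : i ∈ Finset.univ) =>
    min_le_convexCombination (φ i ^ 2) (σ₀ ^ 2) (re_diag_mem_Icc hP hPP i)
  linarith [sq_nonneg ‖X - P * rectDiagonal 𝕜 m n φ‖]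

theorem hardThreshold_zero (σ₀ : ℝ) : hardThreshold σ₀ 0 = 0 := by
  unfold hardThreshold; split_ifs <;> rfl

theorem rectDiagonal_sub (φ ψ : ℕ → ℝ) :
    rectDiagonal 𝕜 m n φ - rectDiagonal 𝕜 m n ψ = rectDiagonal 𝕜 m n fun i => φ i - ψ i := by
  ext i j
  simp only [rectDiagonal, Matrix.sub_apply, of_apply]
  split_ifs <;> simp

theorem rank_penalty_hardThreshold_le {σ₀ : ℝ} (hσ₀ : 0 ≤ σ₀) {φ : ℕ → ℝ}
    (hφ : ∀ i, n ≤ i → φ i = 0) (hφ0 : ∀ i, 0 ≤ φ i) :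
    σ₀ ^ 2 * ((rectDiagonal 𝕜 m n fun i => hardThreshold σ₀ (φ i)).rank : ℝ) +
      ‖(rectDiagonal 𝕜 m n fun i => hardThreshold σ₀ (φ i)) - rectDiagonal 𝕜 m n φ‖ ^ 2 ≤
      ∑ i : Fin m, min (φ i ^ 2) (σ₀ ^ 2) := by
  rw [rectDiagonal_sub, norm_sq_rectDiagonal fun i hi => by rw [hφ i hi, hardThreshold_zero, sub_zero]]
  refine (add_le_add_left (mul_le_mul_of_nonneg_left (rank_rectDiagonal_le _) (sq_nonneg σ₀)) _).trans
    ?_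
  rw [Finset.mul_sum, ← Finset.sum_add_distrib]
  refine Finset.sum_le_sum fun i _ => ?_
  have h0 := hφ0 i
  unfold hardThreshold
  by_cases h1 : φ i < σ₀
  · have : φ i ^ 2 ≤ σ₀ ^ 2 := pow_le_pow_left₀ h0 h1.le 2
    simp [h1, this]
  · have : σ₀ ^ 2 ≤ φ i ^ 2 := pow_le_pow_left₀ hσ₀ (not_lt.mp h1) 2
    rw [min_eq_right this]
    -- A kept entry φ i = 0 forces σ₀ = 0; it adds nothing to the rank.
    by_cases h2 : φ i = 0 <;> simp [h1, h2, sq_nonneg]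

theorem norm_hardThreshold_sub_sq_le {σ₀ : ℝ} (hσ₀ : 0 ≤ σ₀) {φ : ℕ → ℝ}
    (hφ : ∀ i, n ≤ i → φ i = 0) (hφ0 : ∀ i, 0 ≤ φ i) :
    ‖(rectDiagonal 𝕜 m n fun i => hardThreshold σ₀ (φ i)) - rectDiagonal 𝕜 m n φ‖ ^ 2 ≤
      m * σ₀ ^ 2 := by
  have h1 := rank_penalty_hardThreshold_le (𝕜 := 𝕜) (m := m) hσ₀ hφ hφ0
  have h2 : ∑ i : Fin m, min (φ i ^ 2) (σ₀ ^ 2) ≤ m * σ₀ ^ 2 :=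
    (Finset.sum_le_sum fun i _ => min_le_right _ _).trans (by simp)
  have h3 : 0 ≤ σ₀ ^ 2 * ((rectDiagonal 𝕜 m n fun i => hardThreshold σ₀ (φ i)).rank : ℝ) := by
    positivity
  linarith

/-- Equality must hold in every term of the lower bound and X = PD. Away from the threshold this
makes p i equal to 0 or 1, which determines the whole column of P. -/
theorem eq_hardThreshold_of_rank_penalty_le {σ₀ : ℝ} (hσ₀ : 0 ≤ σ₀) {φ : ℕ → ℝ}
    (hφ : ∀ i, n ≤ i → φ i = 0) (hφ0 : ∀ i, 0 ≤ φ i) (hne : ∀ i < min m n, φ i ≠ σ₀)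
    {X : Matrix (Fin m) (Fin n) 𝕜}
    (hX : σ₀ ^ 2 * (X.rank : ℝ) + ‖X - rectDiagonal 𝕜 m n φ‖ ^ 2 ≤
      ∑ i : Fin m, min (φ i ^ 2) (σ₀ ^ 2)) :
    X = rectDiagonal 𝕜 m n fun i => hardThreshold σ₀ (φ i) := by
  obtain ⟨P, hP, hPP, h⟩ := rank_penalty_rectDiagonal_eq σ₀ hφ X
  rw [h] at hX
  have hterm := fun (i : Fin m) (_ : i ∈ Finset.univ) =>
    min_le_convexCombination (φ i ^ 2) (σ₀ ^ 2) (re_diag_mem_Icc hP hPP i)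
  have hsum := Finset.sum_le_sum hterm
  have hXP : X = P * rectDiagonal 𝕜 m n φ := by
    have : ‖X - P * rectDiagonal 𝕜 m n φ‖ ^ 2 = 0 :=
      le_antisymm (by linarith) (sq_nonneg _)
    exact sub_eq_zero.mp (norm_eq_zero.mp (pow_eq_zero_iff two_ne_zero |>.mp this))
  have heq := (Finset.sum_eq_sum_iff_of_le hterm).mp
    (le_antisymm hsum (by linarith [sq_nonneg ‖X - P * rectDiagonal 𝕜 m n φ‖]))
  rw [hXP]
  ext i j
  -- Column j of D is zero here, whatever P is.
  by_cases hj0 : φ j = 0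
  · have h1 : (rectDiagonal 𝕜 m n fun i => hardThreshold σ₀ (φ i)) i j = 0 := by
      simp [rectDiagonal, hj0, hardThreshold_zero]
    rw [h1, Matrix.mul_apply]
    refine Finset.sum_eq_zero fun k _ => ?_
    simp [rectDiagonal, hj0]
  by_cases hjm : (j : ℕ) < m
  · have hPD : (P * rectDiagonal 𝕜 m n φ) i j = P i ⟨j, hjm⟩ * ((φ j : ℝ) : 𝕜) := by
      rw [Matrix.mul_apply, Finset.sum_eq_single (⟨j, hjm⟩ : Fin m)]
      · simp [rectDiagonal]
      · intro k _ hk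
        have : (k : ℕ) ≠ j := fun h => hk (Fin.ext h)
        simp [rectDiagonal, this]
      · simp
    have hpos : 0 < φ j := lt_of_le_of_ne (hφ0 j) (Ne.symm hj0)
    have hj := heq ⟨j, hjm⟩ (Finset.mem_univ _)
    simp only at hj
    rw [hPD]
    rcases lt_or_gt_of_ne (hne j (lt_min hjm j.2)) with hlt | hgt
    · have hsq : φ j ^ 2 < σ₀ ^ 2 := by nlinarith
      rw [min_eq_left hsq.le] at hj
      have hp : RCLike.re (P ⟨j, hjm⟩ ⟨j, hjm⟩) = 0 := by
        have : (σ₀ ^ 2 - φ j ^ 2) * RCLike.re (P ⟨j, hjm⟩ ⟨j, hjm⟩) = 0 := by linarith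
        exact (mul_eq_zero.mp this).resolve_left (by linarith)
      rw [column_eq_zero_of_re_diag_eq_zero hP hPP hp]
      simp [rectDiagonal, hardThreshold, hlt]
    · have hsq : σ₀ ^ 2 < φ j ^ 2 := by nlinarith
      rw [min_eq_right hsq.le] at hj
      have hp : RCLike.re (P ⟨j, hjm⟩ ⟨j, hjm⟩) = 1 := by
        have : (φ j ^ 2 - σ₀ ^ 2) * (1 - RCLike.re (P ⟨j, hjm⟩ ⟨j, hjm⟩)) = 0 := by linarith
        linarith [(mul_eq_zero.mp this).resolve_left (by linarith)]
      rw [column_eq_of_re_diag_eq_one hP hPP hp, Matrix.one_apply]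
      by_cases hij : (i : ℕ) = j
      · simp [rectDiagonal, hardThreshold, hij, not_lt.mpr hgt.le, Fin.ext_iff]
      · simp [rectDiagonal, hij, Fin.ext_iff]
  · have h1 : ∀ k : Fin m, (k : ℕ) ≠ j := fun k => by omega
    rw [Matrix.mul_apply]
    simp [rectDiagonal, h1]

/-! ### Transfer to arbitrary matrices by singular value decomposition. -/

theorem singularValue_nonneg (A : Matrix (Fin m) (Fin n) 𝕜) (j : ℕ) : 0 ≤ singularValue A j :=
  LinearMap.singularValues_nonneg _ j

theorem rank_penalty_unitary_mul (σ₀ : ℝ) {U : Matrix (Fin m) (Fin m) 𝕜}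
    {V : Matrix (Fin n) (Fin n) 𝕜} (hU : U ∈ unitaryGroup (Fin m) 𝕜)
    (hV : V ∈ unitaryGroup (Fin n) 𝕜) (X D : Matrix (Fin m) (Fin n) 𝕜) :
    σ₀ ^ 2 * ((U * X * Vᴴ).rank : ℝ) + ‖U * X * Vᴴ - U * D * Vᴴ‖ ^ 2 =
      σ₀ ^ 2 * (X.rank : ℝ) + ‖X - D‖ ^ 2 := by
  rw [← Matrix.sub_mul, ← Matrix.mul_sub, frobenius_norm_sq_unitary_mul hU hV,
    rank_unitary_mul hU hV]

theorem exists_eq_unitary_mul {U : Matrix (Fin m) (Fin m) 𝕜}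
    {V : Matrix (Fin n) (Fin n) 𝕜} (hU : U ∈ unitaryGroup (Fin m) 𝕜)
    (hV : V ∈ unitaryGroup (Fin n) 𝕜) (X : Matrix (Fin m) (Fin n) 𝕜) :
    ∃ Y : Matrix (Fin m) (Fin n) 𝕜, X = U * Y * Vᴴ := by
  have hU' : U * Uᴴ = 1 := mem_unitaryGroup_iff.mp hU
  have hV' : V * Vᴴ = 1 := mem_unitaryGroup_iff.mp hV
  refine ⟨Uᴴ * X * V, ?_⟩
  calc X = (U * Uᴴ) * X * (V * Vᴴ) := by rw [hU', hV', Matrix.one_mul, Matrix.mul_one]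
    _ = _ := by simp only [Matrix.mul_assoc]

theorem exists_unitary_singularValueCalculus_eq {f : ℝ → ℝ} (hf : f 0 = 0)
    (A : Matrix (Fin m) (Fin n) 𝕜) :
    ∃ U ∈ unitaryGroup (Fin m) 𝕜, ∃ V ∈ unitaryGroup (Fin n) 𝕜,
      A = U * rectDiagonal 𝕜 m n (singularValue A) * Vᴴ ∧
      singularValueCalculus f A = U * rectDiagonal 𝕜 m n (fun j => f (singularValue A j)) * Vᴴ := by
  obtain ⟨U, V, hUV⟩ := exists_isSVD A
  exact ⟨U, hUV.1, V, hUV.2.1, hUV.2.2, singularValueCalculus_eq_of_isSVD f hf A U V hUV⟩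

theorem singularValue_eq_zero_of_width_le (A : Matrix (Fin m) (Fin n) 𝕜) (j : ℕ) (hj : n ≤ j) :
    singularValue A j = 0 :=
  singularValue_eq_zero A ((min_le_right _ _).trans hj)

/-- Hard thresholding of the singular values minimizes the rank-penalized distance. -/
theorem rank_penalty_singularValueCalculus_le {σ₀ : ℝ} (hσ₀ : 0 ≤ σ₀)
    (A X : Matrix (Fin m) (Fin n) 𝕜) :
    σ₀ ^ 2 * ((singularValueCalculus (hardThreshold σ₀) A).rank : ℝ) +
      ‖singularValueCalculus (hardThreshold σ₀) A - A‖ ^ 2 ≤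
      σ₀ ^ 2 * (X.rank : ℝ) + ‖X - A‖ ^ 2 := by
  obtain ⟨U, hU, V, hV, hA, hSA⟩ :=
    exists_unitary_singularValueCalculus_eq (hardThreshold_zero σ₀) A
  have hφ := singularValue_eq_zero_of_width_le A
  have hφ0 := singularValue_nonneg A
  obtain ⟨Y, rfl⟩ := exists_eq_unitary_mul hU hV X
  rw [hSA]
  -- A occurs in its own decomposition through its singular values; making these an arbitrary
  -- sequence φ allows A to be eliminated.
  generalize singularValue A = φ at *
  subst hA
  rw [rank_penalty_unitary_mul σ₀ hU hV, rank_penalty_unitary_mul σ₀ hU hV]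
  exact (rank_penalty_hardThreshold_le hσ₀ hφ hφ0).trans (sum_min_le_rank_penalty σ₀ hφ Y)

/-- The minimizer of the rank-penalized distance is unique if no singular value is at the
threshold. -/
theorem eq_singularValueCalculus_of_rank_penalty_le {σ₀ : ℝ} (hσ₀ : 0 ≤ σ₀)
    {A X : Matrix (Fin m) (Fin n) 𝕜} (hne : ∀ j < min m n, singularValue A j ≠ σ₀)
    (hX : ∀ Y : Matrix (Fin m) (Fin n) 𝕜,
      σ₀ ^ 2 * (X.rank : ℝ) + ‖X - A‖ ^ 2 ≤ σ₀ ^ 2 * (Y.rank : ℝ) + ‖Y - A‖ ^ 2) :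
    X = singularValueCalculus (hardThreshold σ₀) A := by
  obtain ⟨U, hU, V, hV, hA, hSA⟩ :=
    exists_unitary_singularValueCalculus_eq (hardThreshold_zero σ₀) A
  have hφ := singularValue_eq_zero_of_width_le A
  have hφ0 := singularValue_nonneg A
  obtain ⟨Y, rfl⟩ := exists_eq_unitary_mul hU hV X
  have h := hX (singularValueCalculus (hardThreshold σ₀) A)
  rw [hSA] at h ⊢
  clear hSA hX
  generalize singularValue A = φ at *
  subst hA
  rw [rank_penalty_unitary_mul σ₀ hU hV, rank_penalty_unitary_mul σ₀ hU hV] at h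
  rw [eq_hardThreshold_of_rank_penalty_le hσ₀ hφ hφ0 hne
    (h.trans (rank_penalty_hardThreshold_le hσ₀ hφ hφ0))]

/-- The bound is independent of A; it is the constant C that keeps the dual iterates bounded. -/
theorem norm_singularValueCalculus_sub_le {σ₀ : ℝ} (hσ₀ : 0 ≤ σ₀)
    (A : Matrix (Fin m) (Fin n) 𝕜) :
    ‖singularValueCalculus (hardThreshold σ₀) A - A‖ ≤ √(m * σ₀ ^ 2) := by
  obtain ⟨U, hU, V, hV, hA, hSA⟩ :=
    exists_unitary_singularValueCalculus_eq (hardThreshold_zero σ₀) A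
  have hφ := singularValue_eq_zero_of_width_le A
  have hφ0 := singularValue_nonneg A
  rw [hSA]
  clear hSA
  generalize singularValue A = φ at *
  subst hA
  refine Real.le_sqrt_of_sq_le ?_
  rw [← Matrix.sub_mul, ← Matrix.mul_sub, frobenius_norm_sq_unitary_mul hU hV]
  exact norm_hardThreshold_sub_sq_le hσ₀ hφ hφ0

/-- Completing the square in the Lagrangian of a rank-penalized least-squares problem. -/
theorem rank_penalty_add_inner_eq (σ₀ : ℝ) (F Λ X : Matrix (Fin m) (Fin n) 𝕜) :
    σ₀ ^ 2 * (X.rank : ℝ) + ‖X - F‖ ^ 2 + RCLike.re (inner 𝕜 X Λ) =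
      σ₀ ^ 2 * (X.rank : ℝ) + ‖X - (F - ((1 / 2 : ℝ) : 𝕜) • Λ)‖ ^ 2 +
        (RCLike.re (inner 𝕜 F Λ) - ‖((1 / 2 : ℝ) : 𝕜) • Λ‖ ^ 2) := by
  have h : X - (F - ((1 / 2 : ℝ) : 𝕜) • Λ) = (X - F) + ((1 / 2 : ℝ) : 𝕜) • Λ := by abel
  rw [h, norm_add_sq (𝕜 := 𝕜), inner_smul_right, RCLike.re_ofReal_mul, inner_sub_left, map_sub]
  ring

end RankPenalty

/-! ### Application to the rank functional. -/

theorem mainTheorem5 {𝕜 : Type*} [RCLike 𝕜] {m n : ℕ}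
    (σ₀ : ℝ) (hσ₀ : 0 ≤ σ₀) (F : Matrix (Fin m) (Fin n) 𝕜)
    (M : Submodule 𝕜 (Matrix (Fin m) (Fin n) 𝕜))
    (α : ℕ → ℝ) (hα : ∀ i, 0 < α i ∧ α i ≤ 1)
    (hαlim : Tendsto
      (fun N : ℕ => (∑ i ∈ Finset.Icc 1 N, α i ^ 2) / ∑ i ∈ Finset.Icc 1 N, α i) atTop (𝓝 0))
    (X Λ : ℕ → Matrix (Fin m) (Fin n) 𝕜)
    (hΛ0 : Λ 0 = 0)
    (hX : ∀ i, X (i + 1) =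
      singularValueCalculus (hardThreshold σ₀) (F - (1 / 2 : ℝ) • Λ i))
    (hΛ : ∀ i, Λ (i + 1) = Λ i + α i • Mᗮ.starProjection (X (i + 1)))
    (ν : ℕ → ℕ)
    (hν : ∀ k, ν k ≤ k ∧ ∀ i ≤ k,
      -fenchelConjugate 𝕜 (rankObjective σ₀ F) (-Λ i) ≤
        -fenchelConjugate 𝕜 (rankObjective σ₀ F) (-Λ (ν k))) :
    (∃ (κ : ℕ → ℕ) (Xs Λs : Matrix (Fin m) (Fin n) 𝕜), StrictMono κ ∧
      Tendsto (fun j => X (ν (κ j) + 1)) atTop (𝓝 Xs) ∧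
      Tendsto (fun j => Λ (ν (κ j))) atTop (𝓝 Λs)) ∧
    ∀ (κ : ℕ → ℕ) (Xs Λs : Matrix (Fin m) (Fin n) 𝕜), StrictMono κ →
      Tendsto (fun j => X (ν (κ j) + 1)) atTop (𝓝 Xs) →
      Tendsto (fun j => Λ (ν (κ j))) atTop (𝓝 Λs) →
      (∀ j < min m n, singularValue (F - (1 / 2 : ℝ) • Λs) j ≠ σ₀) →
      Xs ∈ M ∧ IsMinOn (fenchelBiconjugate 𝕜 (rankObjective σ₀ F)) M Xs := by
  have hsmul : ∀ (a : ℝ) (Y : Matrix (Fin m) (Fin n) 𝕜), a • Y = (a : 𝕜) • Y := fun a Y => by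
    ext; simp [RCLike.real_smul_eq_coe_mul]
  simp only [hsmul] at hX hΛ ⊢
  set N : Matrix (Fin m) (Fin n) 𝕜 → ℝ := fun X => σ₀ ^ 2 * (X.rank : ℝ) + ‖X - F‖ ^ 2 with hNdef
  set S : Matrix (Fin m) (Fin n) 𝕜 → Matrix (Fin m) (Fin n) 𝕜 := fun Λ =>
    singularValueCalculus (hardThreshold σ₀) (F - ((1 / 2 : ℝ) : 𝕜) • Λ) with hSdef
  have hN : LowerSemicontinuous N := lowerSemicontinuous_rank_penalty σ₀ F
  have hS : IsLagrangianMinimizer 𝕜 N S := fun Λ X => by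
    simp only [hNdef, rank_penalty_add_inner_eq]
    exact add_le_add_left (rank_penalty_singularValueCalculus_le hσ₀ _ X) _
  have hXS : ∀ i, X (i + 1) = S (Λ i) := hX
  simp only [hXS] at hΛ ⊢
  -- The dual value is -N*(-Λ), so the choice of ν picks the best dual iterate so far.
  have hν' : ∀ k, ∀ i ≤ k, dualValue 𝕜 N S (Λ i) ≤ dualValue 𝕜 N S (Λ (ν k)) := by
    intro k i hi
    have h := (hν k).2 i hi
    rw [show rankObjective σ₀ F = fun X => (N X : EReal) from rfl, fenchelConjugate_neg_eq hS,
      fenchelConjugate_neg_eq hS, EReal.neg_le_neg_iff, EReal.coe_le_coe_iff] at h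
    exact neg_le_neg_iff.mp h
  obtain ⟨h1, h2⟩ := dual_ascent_best_iterate (M := M) hN hS
    (fun Λ => norm_singularValueCalculus_sub_le hσ₀ (F - ((1 / 2 : ℝ) : 𝕜) • Λ))
    hα hαlim hΛ0 hΛ hν'
  refine ⟨h1, fun κ Xs Λs hκ hX' hL hne => h2 κ Xs Λs hκ hX' hL fun Y hY => ?_⟩
  -- After completing the square, Y minimizes the rank-penalized distance to F - Λs/2, where the
  -- condition on singular values gives uniqueness.
  refine eq_singularValueCalculus_of_rank_penalty_le hσ₀ hne fun Z => ?_
  have := hY Z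
  simp only [hNdef, rank_penalty_add_inner_eq] at this
  linarith
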